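/- Let $K$ be an infinite field, $P=K[x_1,\dots,x_n]$ with the degree reverse lexicographic term order such that $x_n\prec\cdots\prec x_1$, and let $I\subseteq P$ be an ideal generated by finitely many homogeneous polynomials. Let $\mathrm{HS}_I(t)=\sum_{s\ge 0}\dim_K\big((P/I)_s\big)\,t^s$ be the Hilbert series of $P/I$. (1) If $I\neq P$ and $D$ denotes the (finite) Krull dimension of $P/I$, then $$\mathrm{HS}_I(t)=\frac{N(t)}{(1-t)^D}$$ for some polynomial $N\in\mathbb{Z}[t]$ with $N(1)\neq 0$. (2) If $I$ is in quasi-stable position, then $I$ has a (finite) Pommaret basis; and whenever $H=\{h_1,\dots,h_s\}$ (with $h_1,\dots,h_s$ distinct) is a Pommaret basis of $I$, $$\mathrm{HS}_I(t)=\frac{1-\sum_{i=1}^{s}(1-t)^{n_i}\,t^{c_i}}{(1-t)^n},$$ where $c_i$ is the total degree of the leading term $\mathrm{LT}(h_i)$ and $n_i$ is the number of its non-multiplicative variables. Here $\mathrm{LT}(I)$ is the ideal generated by the leading terms of the nonzero elements of $I$. The multiplicative variables $X(m)$ of a term $m\neq 1$ are $x_c,\dots,x_n$, where $c$ is the largest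 index of a variable dividing $m$; all variables are multiplicative for $m=1$. A term $m$ is a Pommaret divisor of a term $m'$ if $m\mid m'$ and $m'/m\in K[X(m)]$. A finite set $H\subset I\setminus\{0\}$ is a Pommaret basis of $I$ if no leading term of an element of $H$ is a Pommaret divisor of the leading term of another element of $H$, and $\mathrm{LT}(I)=\bigoplus_{h\in H}K[X(\mathrm{LT}(h))]\cdot \mathrm{LT}(h)$ as $K$-vector spaces. The ideal $I$ is in quasi-stable position if for every term $m\in\mathrm{LT}(I)$, all $1\le j<i\le n$ and all $s>0$ with $x_i^s\mid m$ there is an integer $t\ge 0$ with $x_j^t\,m/x_i^s\in\mathrm{LT}(I)$. -/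

import Mathlib

/-- Exponent vectors of terms in `n` variables, carrying the degree reverse lexicographic order.
The variable usually written `x_{i+1}` is indexed by `i : Fin n`. -/
def DegRevLex (n : ℕ) : Type := Fin n →₀ ℕ

namespace DegRevLex

variable {n : ℕ}

noncomputable instance : AddCommMonoid (DegRevLex n) :=
  inferInstanceAs (AddCommMonoid (Fin n →₀ ℕ))

/-- The sort key: first the total degree; then the exponents, read from the last variable to the
first one and compared lexicographically, with the resulting order reversed. -/
noncomputable def key (a : Fin n →₀ ℕ) : ℕ ×ₗ (Lex (Fin n → ℕ))ᵒᵈ :=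
  toLex (a.degree, OrderDual.toDual (toLex (fun i : Fin n => a i.rev)))

theorem key_injective : Function.Injective (key (n := n)) := by
  intro a b h
  have h2 : (fun i : Fin n => a i.rev) = fun i : Fin n => b i.rev :=
    toLex.injective (OrderDual.toDual.injective (congrArg Prod.snd (toLex.injective h)))
  ext i
  simpa using congrFun h2 i.rev

noncomputable instance : LinearOrder (DegRevLex n) :=
  LinearOrder.lift' (key (n := n)) key_injective

/-- `x^a` is smaller than `x^b` iff it has smaller degree, or the degrees agree and the last
exponent in which `a` and `b` differ is larger in `a`. -/
theorem key_lt_iff {a b : Fin n →₀ ℕ} :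
    key a < key b ↔ a.degree < b.degree ∨
      a.degree = b.degree ∧ ∃ i, (∀ j, i < j → a j = b j) ∧ b i < a i := by
  simp only [key, Prod.Lex.toLex_lt_toLex, OrderDual.toDual_lt_toDual]
  refine or_congr Iff.rfl (and_congr Iff.rfl ?_)
  constructor
  · rintro ⟨i, hi, hlt⟩
    refine ⟨i.rev, fun j hj => ?_, hlt⟩
    have := hi j.rev (show j.rev < i by rwa [Fin.rev_lt_iff])
    simpa using this.symm
  · rintro ⟨i, hi, hlt⟩
    refine ⟨i.rev, fun j hj => ?_, by simpa using hlt⟩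
    exact (hi j.rev (by rwa [Fin.lt_rev_iff])).symm

theorem lt_iff {a b : DegRevLex n} : a < b ↔ key a < key b := Iff.rfl

theorem le_iff {a b : DegRevLex n} : a ≤ b ↔ key a ≤ key b := Iff.rfl

theorem key_add_lt {a b : Fin n →₀ ℕ} (h : key a < key b) (c : Fin n →₀ ℕ) :
    key (c + a) < key (c + b) := by
  rw [key_lt_iff] at h ⊢
  simpa [map_add] using h

instance : IsOrderedAddMonoid (DegRevLex n) where
  add_le_add_left a b h c := by
    rcases h.lt_or_eq with h | h
    · rw [add_comm a c, add_comm b c]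
      exact (key_add_lt h c).le
    · rw [h]

instance : WellFoundedLT (DegRevLex n) where
  wf := by
    have hfin : ∀ d : ℕ, {a : Fin n →₀ ℕ | a.degree ≤ d}.Finite := Finsupp.finite_of_degree_le
    rw [WellFounded.wellFounded_iff_has_min]
    intro s hs
    obtain ⟨a, ha⟩ := hs
    obtain ⟨m, hm, hmin⟩ := Set.exists_min_image
      (s ∩ {b : DegRevLex n | Finsupp.degree (b : Fin n →₀ ℕ) ≤ Finsupp.degree (a : Fin n →₀ ℕ)})
      id ((hfin _).subset Set.inter_subset_right) ⟨a, ha, le_refl (Finsupp.degree (a : Fin n →₀ ℕ))⟩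
    refine ⟨m, hm.1, fun b hb hlt => ?_⟩
    have hdeg : Finsupp.degree (b : Fin n →₀ ℕ) ≤ Finsupp.degree (m : Fin n →₀ ℕ) := by
      rcases key_lt_iff.1 hlt with h | h
      · exact h.le
      · exact h.1.le
    exact absurd hlt (not_lt.2 (hmin b ⟨hb, hdeg.trans hm.2⟩))

theorem key_monotone {a b : Fin n →₀ ℕ} (h : a ≤ b) : key a ≤ key b := by
  obtain ⟨c, rfl⟩ := exists_add_of_le h
  rcases eq_or_ne c 0 with rfl | hc
  · simp
  · refine (key_lt_iff.2 (Or.inl ?_)).le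
    have : c.degree ≠ 0 := by rwa [Ne, Finsupp.degree_eq_zero_iff]
    rw [map_add]
    omega

end DegRevLex

/-- The degree reverse lexicographic term order on `n` variables, in which the first variable
(index `0`) is the largest one and the last variable the smallest one. -/
noncomputable def degRevLex (n : ℕ) : MonomialOrder (Fin n) where
  syn := DegRevLex n
  toSyn := { toEquiv := Equiv.refl (Fin n →₀ ℕ), map_add' := fun _ _ => rfl }
  toSyn_monotone _ _ h := DegRevLex.key_monotone h

open scoped MonomialOrder in
theorem degRevLex_lt_iff {n : ℕ} {a b : Fin n →₀ ℕ} :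
    a ≺[degRevLex n] b ↔ a.degree < b.degree ∨
      a.degree = b.degree ∧ ∃ i, (∀ j, i < j → a j = b j) ∧ b i < a i :=
  DegRevLex.key_lt_iff

namespace Pommaret

open MvPolynomial

variable {K : Type*} [Field K] {n : ℕ}

/-- The Hilbert function of `P/I`, for `P = K[x_1,…,x_n]`: the dimension over `K` of the degree
`s` part of `P/I`, i.e. of the image of the homogeneous polynomials of degree `s`. -/
noncomputable def hilbertFunction (I : Ideal (MvPolynomial (Fin n) K)) (s : ℕ) : ℕ :=
  Module.finrank K
    ((homogeneousSubmodule (Fin n) K s).map (Ideal.Quotient.mkₐ K I).toLinearMap)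

/-- The Hilbert series of `P/I`, as a formal power series with integer coefficients. -/
noncomputable def hilbertSeries (I : Ideal (MvPolynomial (Fin n) K)) : PowerSeries ℤ :=
  PowerSeries.mk fun s => (hilbertFunction I s : ℤ)

/-- The exponent vector of the leading term of `f` (for `f ≠ 0`). -/
noncomputable def ltExp (f : MvPolynomial (Fin n) K) : Fin n →₀ ℕ :=
  (degRevLex n).degree f

/-- The leading ideal of `I`, generated by the leading terms of the nonzero elements of `I`. -/
noncomputable def leadingIdeal (I : Ideal (MvPolynomial (Fin n) K)) :
    Ideal (MvPolynomial (Fin n) K) :=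
  Ideal.span {p | ∃ f ∈ I, f ≠ 0 ∧ p = monomial (ltExp f) 1}

/-- A monomial ideal `J` is quasi-stable if for each term `m ∈ J`, all `j < i` and all `s > 0` with
`x_i^s ∣ m` there is some `t ≥ 0` with `x_j^t m / x_i^s ∈ J`. -/
def IsQuasiStable (J : Ideal (MvPolynomial (Fin n) K)) : Prop :=
  (∃ S : Set (Fin n →₀ ℕ), J = Ideal.span ((fun a => monomial a (1 : K)) '' S)) ∧
  ∀ a : Fin n →₀ ℕ, monomial a (1 : K) ∈ J →
    ∀ i j : Fin n, j < i → ∀ s : ℕ, 0 < s → s ≤ a i →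
      ∃ t : ℕ, monomial (a - Finsupp.single i s + Finsupp.single j t) (1 : K) ∈ J

/-- `I` is in quasi-stable position if its leading ideal is quasi-stable. -/
def IsInQuasiStablePosition (I : Ideal (MvPolynomial (Fin n) K)) : Prop :=
  IsQuasiStable (leadingIdeal I)

/-- The multiplicative variables of the term `x^a`: the variables `x_c, …, x_n`, where the class
`c` is the largest index of a variable dividing `x^a`. For `x^a = 1` all variables are
multiplicative. -/
def multVars (a : Fin n →₀ ℕ) : Finset (Fin n) :=
  Finset.univ.filter fun i => ∀ j, a j ≠ 0 → j ≤ i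

/-- `x^b` is a Pommaret divisor of `x^a`: it divides `x^a`, and the quotient contains only
multiplicative variables of `x^b`. -/
def PommaretDvd (b a : Fin n →₀ ℕ) : Prop :=
  b ≤ a ∧ (a - b).support ⊆ multVars b

/-- The `K`-linear subspace `K[X_P(x^a)] · x^a` of the polynomial ring, where `X_P(x^a)` is the set
of multiplicative variables of `x^a`. -/
noncomputable def cone (K : Type*) [Field K] {n : ℕ} (a : Fin n →₀ ℕ) :
    Submodule K (MvPolynomial (Fin n) K) :=
  (Subalgebra.toSubmodule (supported K (multVars a : Set (Fin n)))).map
    (LinearMap.mulRight K (monomial a (1 : K)))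

/-- The finite set `H` is a Pommaret basis of `I`: it consists of nonzero elements of `I`, no
leading term of an element is a Pommaret divisor of the leading term of another element, and the
leading ideal of `I` is the (internal) direct sum of the cones of the leading terms. -/
structure IsPommaretBasis (I : Ideal (MvPolynomial (Fin n) K))
    (H : Finset (MvPolynomial (Fin n) K)) : Prop where
  subset : ∀ h ∈ H, h ∈ I
  ne_zero : ∀ h ∈ H, h ≠ 0
  not_dvd : ∀ h ∈ H, ∀ g ∈ H, h ≠ g → ¬ PommaretDvd (ltExp h) (ltExp g)
  indep : iSupIndep fun h : H => cone K (ltExp h.1)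
  iSup_eq : ⨆ h : H, cone K (ltExp h.1) = (leadingIdeal I).restrictScalars K

/-- The number of non-multiplicative variables of the leading term of `h`. -/
noncomputable def numNonMult (h : MvPolynomial (Fin n) K) : ℕ :=
  n - (multVars (ltExp h)).card

/-- The total degree of the leading term of `h`. -/
noncomputable def ltDeg (h : MvPolynomial (Fin n) K) : ℕ :=
  (ltExp h).degree

end Pommaret

namespace Pommaret

/-! Everything reduces to counting exponent vectors. The terms outside `ltSet I` give a basis of P/I
(Macaulay), compatibly with degree since I is homogeneous, so the Hilbert series is the degree
series of the complement of `ltSet I` (`hilbertSeries_eq`).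

A Pommaret basis partitions `ltSet I` into cones. A cone on a term of degree c with m multiplicative
variables has series t^c/(1-t)^m, and subtracting these from 1/(1-t)^n gives the formula. Such a
basis exists because the Pommaret divisors of a term form a chain (`PommaretDvd.total`): cones on
Pommaret-minimal elements of `ltSet I` are disjoint and cover it, and quasi-stability makes these
elements finite in number (`finite_pommaretMinimal`).

For the pole order, Dickson's lemma and inclusion-exclusion give a numerator M over (1-t)^n. The
number of standard terms of degree at most s is then eventually a polynomial in s of degree n - k,
where k is the order of vanishing of M at 1. Noether normalisation makes P/I finite over a
polynomial ring in D variables, D being the Krull dimension, and comparing degree filtrations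
(`exists_pow_le_finrank`, `exists_finrank_le_pow`) shows that the growth has degree exactly D. Hence
D = n - k, and (1-t)^k cancels. -/

/-- The generating function counting the exponent vectors of a set by their degree. -/
noncomputable def degreeSeries {n : ℕ} (A : Set (Fin n →₀ ℕ)) : PowerSeries ℤ :=
  PowerSeries.mk fun s => ((A ∩ {a | a.degree = s}).ncard : ℤ)

/-! ### Degree series of sets of exponent vectors -/

section DegreeSeries

variable {n : ℕ}

theorem finite_setOf_degree_eq (s : ℕ) : {a : Fin n →₀ ℕ | a.degree = s}.Finite :=
  (Finsupp.finite_of_degree_le s).subset fun _ h => le_of_eq h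

theorem finite_inter_degree_eq (A : Set (Fin n →₀ ℕ)) (s : ℕ) :
    (A ∩ {a | a.degree = s}).Finite :=
  (finite_setOf_degree_eq s).subset Set.inter_subset_right

theorem coeff_degreeSeries (A : Set (Fin n →₀ ℕ)) (s : ℕ) :
    (degreeSeries A).coeff s = ((A ∩ {a | a.degree = s}).ncard : ℤ) :=
  PowerSeries.coeff_mk _ _

@[simp]
theorem degreeSeries_empty : degreeSeries (∅ : Set (Fin n →₀ ℕ)) = 0 := by
  ext s
  simp [coeff_degreeSeries]

theorem degreeSeries_union_add_inter (A B : Set (Fin n →₀ ℕ)) :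
    degreeSeries (A ∪ B) + degreeSeries (A ∩ B) = degreeSeries A + degreeSeries B := by
  ext s
  simp only [map_add, coeff_degreeSeries]
  rw [Set.union_inter_distrib_right, Set.inter_inter_distrib_right]
  exact_mod_cast Set.ncard_union_add_ncard_inter _ _ (finite_inter_degree_eq A s)
    (finite_inter_degree_eq B s)

theorem degreeSeries_union {A B : Set (Fin n →₀ ℕ)} (h : Disjoint A B) :
    degreeSeries (A ∪ B) = degreeSeries A + degreeSeries B := by
  rw [← degreeSeries_union_add_inter, h.inter_eq, degreeSeries_empty, add_zero]

theorem degreeSeries_biUnion {ι : Type*} (H : Finset ι) (A : ι → Set (Fin n →₀ ℕ))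
    (h : (H : Set ι).PairwiseDisjoint A) :
    degreeSeries (⋃ i ∈ H, A i) = ∑ i ∈ H, degreeSeries (A i) := by
  classical
  induction H using Finset.induction_on with
  | empty => simp
  | insert i H hi ih =>
    rw [Finset.set_biUnion_insert, degreeSeries_union, Finset.sum_insert hi, ih]
    · exact h.subset (by simp)
    · rw [Set.disjoint_iUnion₂_right]
      intro j hj
      exact h (by simp) (by simp [hj]) (by rintro rfl; exact hi hj)

theorem degreeSeries_compl (A : Set (Fin n →₀ ℕ)) :
    degreeSeries Aᶜ = degreeSeries (Set.univ : Set (Fin n →₀ ℕ)) - degreeSeries A := by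
  rw [eq_sub_iff_add_eq, add_comm, ← degreeSeries_union disjoint_compl_right, Set.union_compl_self]

theorem degreeSeries_translate (c : Fin n →₀ ℕ) (A : Set (Fin n →₀ ℕ)) :
    degreeSeries ((c + ·) '' A) = PowerSeries.X ^ c.degree * degreeSeries A := by
  ext s
  rw [coeff_degreeSeries, PowerSeries.coeff_X_pow_mul', coeff_degreeSeries]
  split_ifs with h
  · have : (c + ·) '' A ∩ {a | a.degree = s} = (c + ·) '' (A ∩ {a | a.degree = s - c.degree}) := by
      ext a
      constructor
      · rintro ⟨⟨b, hb, rfl⟩, hs⟩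
        refine ⟨b, ⟨hb, ?_⟩, rfl⟩
        simp only [Set.mem_ofPred_eq, map_add] at hs ⊢
        omega
      · rintro ⟨b, ⟨hb, hs⟩, rfl⟩
        refine ⟨⟨b, hb, rfl⟩, ?_⟩
        simp only [Set.mem_ofPred_eq, map_add] at hs ⊢
        omega
    rw [this, Set.ncard_image_of_injective _ (add_right_injective c)]
  · have : (c + ·) '' A ∩ {a | a.degree = s} = ∅ := by
      rw [Set.eq_empty_iff_forall_notMem]
      rintro _ ⟨⟨b, hb, rfl⟩, hs⟩
      simp only [Set.mem_ofPred_eq, map_add] at hs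
      omega
    simp [this]

/-- A term in the variables of `insert i M` either avoids x_i or is x_i times another such term, so
its series F satisfies F = F_M + t F. -/
theorem degreeSeries_support_subset (M : Finset (Fin n)) :
    degreeSeries {a : Fin n →₀ ℕ | a.support ⊆ M} * (1 - PowerSeries.X) ^ M.card = 1 := by
  induction M using Finset.induction_on with
  | empty =>
    have : {a : Fin n →₀ ℕ | a.support ⊆ ∅} = {0} := by
      ext a
      simp
    rw [this, Finset.card_empty, pow_zero, mul_one]
    ext s
    rw [coeff_degreeSeries, PowerSeries.coeff_one]
    split_ifs with h
    · subst h
      rw [Set.inter_eq_left.2 (by simp)]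
      simp
    · rw [Set.singleton_inter_eq_empty.2 (by simpa using Ne.symm h)]
      simp
  | insert i M hi ih =>
    have hunion : {a : Fin n →₀ ℕ | a.support ⊆ insert i M} =
        {a : Fin n →₀ ℕ | a.support ⊆ M} ∪
          (Finsupp.single i 1 + ·) '' {a : Fin n →₀ ℕ | a.support ⊆ insert i M} := by
      ext a
      constructor
      · intro ha
        by_cases hai : a i = 0
        · left
          intro j hj
          rcases Finset.mem_insert.1 (ha hj) with rfl | h
          · exact absurd hai (Finsupp.mem_support_iff.1 hj)
          · exact h
        · right
          refine ⟨a - Finsupp.single i 1, fun j hj => ha ?_, ?_⟩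
          · rw [Finsupp.mem_support_iff] at hj ⊢
            rw [Finsupp.tsub_apply] at hj
            omega
          · exact add_tsub_cancel_of_le (Finsupp.single_le_iff.2 (by omega))
      · rintro (ha | ⟨b, hb, rfl⟩)
        · exact fun j hj => Finset.mem_insert_of_mem (ha hj)
        · intro j hj
          rcases eq_or_ne j i with rfl | hji
          · exact Finset.mem_insert_self _ _
          · refine hb (Finsupp.mem_support_iff.2 ?_)
            simpa [Finsupp.single_apply, hji.symm] using hj
    have hdisj : Disjoint {a : Fin n →₀ ℕ | a.support ⊆ M}
        ((Finsupp.single i 1 + ·) '' {a : Fin n →₀ ℕ | a.support ⊆ insert i M}) := by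
      rw [Set.disjoint_left]
      rintro _ ha ⟨b, hb, rfl⟩
      exact hi (ha (Finsupp.mem_support_iff.2 (by simp)))
    have hseries := congrArg degreeSeries hunion
    rw [degreeSeries_union hdisj, degreeSeries_translate, Finsupp.degree_single, pow_one] at hseries
    rw [Finset.card_insert_of_notMem hi, pow_succ]
    linear_combination (1 - PowerSeries.X) ^ M.card * hseries + ih

theorem degreeSeries_univ :
    degreeSeries (Set.univ : Set (Fin n →₀ ℕ)) * (1 - PowerSeries.X) ^ n = 1 := by
  have := degreeSeries_support_subset (Finset.univ : Finset (Fin n))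
  simpa using this

/-- Dickson's lemma: the minimal elements form an antichain in a well-quasi-order. -/
theorem exists_finset_generators {S : Set (Fin n →₀ ℕ)} (hS : IsUpperSet S) :
    ∃ G : Finset (Fin n →₀ ℕ), S = {a | ∃ g ∈ G, g ≤ a} := by
  have hfin : {a | Minimal (· ∈ S) a}.Finite :=
    WellQuasiOrderedLE.finite_of_isAntichain (setOfPred_minimal_antichain _)
  refine ⟨hfin.toFinset, Set.ext fun a => ⟨fun ha => ?_, ?_⟩⟩
  · obtain ⟨b, hb, hmin⟩ := (Set.isPWO_of_wellQuasiOrderedLE S).exists_le_minimal ha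
    exact ⟨b, hfin.mem_toFinset.2 hmin, hb⟩
  · rintro ⟨g, hg, hga⟩
    exact hS hga (hfin.mem_toFinset.1 hg).1

/-- Inclusion-exclusion on one generator g: the multiples of g meet the upper set of the others in
the upper set of the lcms `b ⊔ g`, which again has fewer generators. Inducting on a bound m rather
than on the cardinality allows lcms to coincide. -/
theorem exists_polynomial_degreeSeries_generated (m : ℕ) (G : Finset (Fin n →₀ ℕ))
    (hG : G.card ≤ m) :
    ∃ N : Polynomial ℤ, degreeSeries {a | ∃ g ∈ G, g ≤ a} * (1 - PowerSeries.X) ^ n =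
      (N : PowerSeries ℤ) := by
  classical
  induction m generalizing G with
  | zero =>
    obtain rfl : G = ∅ := by simpa using hG
    exact ⟨0, by simp⟩
  | succ m ih =>
    rcases G.eq_empty_or_nonempty with rfl | ⟨g, hg⟩
    · exact ⟨0, by simp⟩
    obtain ⟨N₁, hN₁⟩ := ih (G.erase g) (by rw [Finset.card_erase_of_mem hg]; omega)
    obtain ⟨N₂, hN₂⟩ := ih ((G.erase g).image (· ⊔ g))
      (Finset.card_image_le.trans (by rw [Finset.card_erase_of_mem hg]; omega))
    have hprincipal : {a : Fin n →₀ ℕ | g ≤ a} = (g + ·) '' Set.univ := by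
      ext a
      constructor
      · exact fun h => ⟨a - g, trivial, add_tsub_cancel_of_le h⟩
      · rintro ⟨b, -, rfl⟩
        exact le_add_of_nonneg_right (zero_le (a := b))
    have hunion : {a : Fin n →₀ ℕ | ∃ b ∈ G, b ≤ a} =
        {a | g ≤ a} ∪ {a | ∃ b ∈ G.erase g, b ≤ a} := by
      ext a
      simp only [Set.mem_ofPred_eq, Set.mem_union, Finset.mem_erase]
      constructor
      · rintro ⟨b, hb, hba⟩
        rcases eq_or_ne b g with rfl | hne
        · exact Or.inl hba
        · exact Or.inr ⟨b, ⟨hne, hb⟩, hba⟩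
      · rintro (h | ⟨b, ⟨-, hb⟩, hba⟩)
        · exact ⟨g, hg, h⟩
        · exact ⟨b, hb, hba⟩
    have hinter : {a : Fin n →₀ ℕ | g ≤ a} ∩ {a | ∃ b ∈ G.erase g, b ≤ a} =
        {a | ∃ b ∈ (G.erase g).image (· ⊔ g), b ≤ a} := by
      ext a
      simp only [Set.mem_ofPred_eq, Set.mem_inter_iff, Finset.exists_mem_image, sup_le_iff]
      tauto
    have hsum := degreeSeries_union_add_inter {a : Fin n →₀ ℕ | g ≤ a}
      {a | ∃ b ∈ G.erase g, b ≤ a}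
    rw [← hunion, hinter, hprincipal, degreeSeries_translate] at hsum
    refine ⟨Polynomial.X ^ g.degree + N₁ - N₂, ?_⟩
    push_cast
    linear_combination (1 - PowerSeries.X) ^ n * hsum + hN₁ - hN₂ +
      PowerSeries.X ^ g.degree * degreeSeries_univ (n := n)

theorem exists_polynomial_degreeSeries {S : Set (Fin n →₀ ℕ)} (hS : IsUpperSet S) :
    ∃ N : Polynomial ℤ, degreeSeries S * (1 - PowerSeries.X) ^ n = (N : PowerSeries ℤ) := by
  obtain ⟨G, rfl⟩ := exists_finset_generators hS
  exact exists_polynomial_degreeSeries_generated _ G le_rfl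

end DegreeSeries

/-! ### Combinatorics of Pommaret division -/

section PommaretDivision

variable {n : ℕ}

theorem pommaretDvd_iff {b a : Fin n →₀ ℕ} :
    PommaretDvd b a ↔ b ≤ a ∧ ∀ i, b i < a i → ∀ j, b j ≠ 0 → j ≤ i := by
  refine and_congr_right fun _ => ?_
  simp only [Finset.subset_iff, multVars, Finset.mem_filter, Finset.mem_univ, true_and,
    Finsupp.mem_support_iff, Finsupp.tsub_apply, ← pos_iff_ne_zero, tsub_pos_iff_lt]

theorem PommaretDvd.refl (a : Fin n →₀ ℕ) : PommaretDvd a a :=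
  pommaretDvd_iff.2 ⟨le_rfl, fun _ h => absurd h (lt_irrefl _)⟩

theorem PommaretDvd.trans {a b c : Fin n →₀ ℕ} (hab : PommaretDvd a b) (hbc : PommaretDvd b c) :
    PommaretDvd a c := by
  rw [pommaretDvd_iff] at *
  refine ⟨hab.1.trans hbc.1, fun i hi j hj => ?_⟩
  rcases (hab.1 i).lt_or_eq with h | h
  · exact hab.2 i h j hj
  · refine hbc.2 i (h ▸ hi) j ?_
    have := hab.1 j
    omega

/-- If b exceeds c at i and c exceeds b at j, then x_j is multiplicative for b, so i ≤ j;
symmetrically j ≤ i, which is absurd. Hence one divides the other, and the multiplicativity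
condition is inherited. -/
theorem PommaretDvd.total {a b c : Fin n →₀ ℕ} (hb : PommaretDvd b a) (hc : PommaretDvd c a) :
    PommaretDvd b c ∨ PommaretDvd c b := by
  rw [pommaretDvd_iff] at hb hc
  have key : b ≤ c ∨ c ≤ b := by
    by_contra! h
    obtain ⟨⟨i, hi⟩, ⟨j, hj⟩⟩ : (∃ i, c i < b i) ∧ ∃ j, b j < c j := by
      simpa [Finsupp.le_def] using h
    have hij := hb.2 j (hj.trans_le (hc.1 j)) i (by omega)
    have hji := hc.2 i (hi.trans_le (hb.1 i)) j (by omega)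
    obtain rfl := le_antisymm hij hji
    omega
  rcases key with h | h
  · exact Or.inl (pommaretDvd_iff.2 ⟨h, fun i hi => hb.2 i (hi.trans_le (hc.1 i))⟩)
  · exact Or.inr (pommaretDvd_iff.2 ⟨h, fun i hi => hc.2 i (hi.trans_le (hb.1 i))⟩)

/-- The elements of `S` without a proper Pommaret divisor in `S`. -/
def pommaretMinimal (S : Set (Fin n →₀ ℕ)) : Set (Fin n →₀ ℕ) :=
  {b | b ∈ S ∧ ∀ c ∈ S, PommaretDvd c b → c = b}

/-- By transitivity, a divisibility-minimal element among the Pommaret divisors of a in S suffices.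
-/
theorem exists_pommaretMinimal_dvd {S : Set (Fin n →₀ ℕ)} {a : Fin n →₀ ℕ} (ha : a ∈ S) :
    ∃ b ∈ pommaretMinimal S, PommaretDvd b a := by
  obtain ⟨b, hb⟩ := (Set.isPWO_of_wellQuasiOrderedLE {c | c ∈ S ∧ PommaretDvd c a}).exists_minimal
    ⟨a, ha, .refl a⟩
  exact ⟨b, ⟨hb.1.1, fun c hc hcb =>
    le_antisymm hcb.1 (hb.2 ⟨hc, hcb.trans hb.1.2⟩ hcb.1)⟩, hb.1.2⟩

theorem pommaretMinimal_unique {S : Set (Fin n →₀ ℕ)} {a b c : Fin n →₀ ℕ}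
    (hb : b ∈ pommaretMinimal S) (hc : c ∈ pommaretMinimal S) (hba : PommaretDvd b a)
    (hca : PommaretDvd c a) : b = c := by
  rcases hba.total hca with h | h
  · exact hc.2 b hb.1 h
  · exact (hb.2 c hc.1 h).symm

/-- All exponents of a minimal b are bounded. With c the class of b, b/x_c is a Pommaret divisor of
b, so it is not in S. A generator g dividing b therefore has the same exponent at c. For k < c,
quasi-stability trades the full power of x_c in g for some x_k^t; were b_k larger than g_k + t, the
result would divide b/x_c and put it in S. -/
theorem finite_pommaretMinimal {S : Set (Fin n →₀ ℕ)} (hS : IsUpperSet S)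
    (hstable : ∀ a ∈ S, ∀ i j : Fin n, j < i → ∀ s : ℕ, 0 < s → s ≤ a i →
      ∃ t : ℕ, a - Finsupp.single i s + Finsupp.single j t ∈ S) :
    (pommaretMinimal S).Finite := by
  classical
  obtain ⟨G, hG⟩ := exists_finset_generators hS
  have hGS : ∀ g ∈ G, g ∈ S := fun g hg => hG ▸ ⟨g, hg, le_rfl⟩
  -- The side conditions sit inside the existential, with dummy value 0, so that t becomes a total
  -- function and N a finite supremum.
  have hex : ∀ (g : Fin n →₀ ℕ) (i j : Fin n), ∃ t : ℕ, g ∈ G → j < i → 0 < g i →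
      g - Finsupp.single i (g i) + Finsupp.single j t ∈ S := by
    intro g i j
    by_cases h : g ∈ G ∧ j < i ∧ 0 < g i
    · obtain ⟨t, ht⟩ := hstable g (hGS g h.1) i j h.2.1 (g i) h.2.2 le_rfl
      exact ⟨t, fun _ _ _ => ht⟩
    · exact ⟨0, fun h₁ h₂ h₃ => absurd ⟨h₁, h₂, h₃⟩ h⟩
  choose t ht using hex
  let N : ℕ := G.sup fun g => Finset.univ.sup fun i => Finset.univ.sup fun j => g j + t g i j
  have hN : ∀ g ∈ G, ∀ i j, g j + t g i j ≤ N := fun g hg i j =>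
    ((Finset.le_sup (f := fun j => g j + t g i j) (Finset.mem_univ j)).trans
      (Finset.le_sup (f := fun i => Finset.univ.sup fun j => g j + t g i j)
        (Finset.mem_univ i))).trans
      (Finset.le_sup (f := fun g => Finset.univ.sup fun i => Finset.univ.sup fun j =>
        g j + t g i j) hg)
  refine (Set.finite_Icc 0 (Finsupp.equivFunOnFinite.symm fun _ : Fin n => N)).subset ?_
  intro b hb
  refine ⟨zero_le, fun k => ?_⟩
  show b k ≤ N
  by_cases hk : b k = 0
  · omega
  have hne : b.support.Nonempty := ⟨k, Finsupp.mem_support_iff.2 hk⟩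
  let c := b.support.max' hne
  have hc : b c ≠ 0 := Finsupp.mem_support_iff.1 (b.support.max'_mem hne)
  have hmax : ∀ j, b j ≠ 0 → j ≤ c := fun j hj =>
    b.support.le_max' j (Finsupp.mem_support_iff.2 hj)
  have hnot : b - Finsupp.single c 1 ∉ S := by
    intro hmem
    have hdvd : PommaretDvd (b - Finsupp.single c 1) b := by
      refine pommaretDvd_iff.2 ⟨tsub_le_self, fun i hi j hj => ?_⟩
      have hic : i = c := by
        by_contra h
        simp [Ne.symm h] at hi
      rw [hic]
      refine hmax j ?_
      rw [Finsupp.tsub_apply] at hj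
      omega
    have := DFunLike.congr_fun (hb.2 _ hmem hdvd) c
    simp at this
    omega
  obtain ⟨g, hg, hgb⟩ : ∃ g ∈ G, g ≤ b := by
    have := hb.1
    rwa [hG] at this
  have hgc : g c = b c := by
    by_contra h
    refine hnot (hS (fun i => ?_) (hGS g hg))
    rw [Finsupp.tsub_apply, Finsupp.single_apply]
    have := hgb i
    split_ifs with hic
    · subst hic
      omega
    · simpa using this
  rcases (hmax k hk).lt_or_eq with hkc | hkc
  · by_contra! hlt
    refine hnot (hS (fun i => ?_) (ht g c k hg hkc (by omega)))
    have hi := hgb i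
    have hNk := hN g hg c k
    simp only [Finsupp.add_apply, Finsupp.tsub_apply, Finsupp.single_apply]
    split_ifs with h₁ h₂ h₂ <;> subst_vars <;> omega
  · have := hN g hg c c
    rw [hkc]
    omega

end PommaretDivision
end Pommaret

namespace Pommaret

/-! ### Standard monomials and the Hilbert function -/

section LeadingExponents

open MvPolynomial
open scoped MonomialOrder

variable {K : Type*} [Field K] {n : ℕ}

/-- The exponent vectors of the leading terms of the nonzero elements of `I`. -/
def ltSet (I : Ideal (MvPolynomial (Fin n) K)) : Set (Fin n →₀ ℕ) :=
  {a | ∃ f ∈ I, f ≠ 0 ∧ ltExp f = a}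

theorem isUpperSet_ltSet (I : Ideal (MvPolynomial (Fin n) K)) : IsUpperSet (ltSet I) := by
  classical
  rintro a b hab ⟨f, hf, hf0, rfl⟩
  have hm : monomial (b - ltExp f) (1 : K) ≠ 0 := by simp
  refine ⟨f * monomial (b - ltExp f) 1, I.mul_mem_right _ hf, mul_ne_zero hf0 hm, ?_⟩
  rw [ltExp, MonomialOrder.degree_mul hf0 hm, MonomialOrder.degree_monomial, if_neg one_ne_zero]
  exact add_tsub_cancel_of_le hab

theorem leadingIdeal_eq_span (I : Ideal (MvPolynomial (Fin n) K)) :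
    leadingIdeal I = Ideal.span ((fun a => monomial a (1 : K)) '' ltSet I) := by
  refine congrArg Ideal.span (Set.ext fun p => ⟨?_, ?_⟩)
  · rintro ⟨f, hf, hf0, rfl⟩
    exact ⟨_, ⟨f, hf, hf0, rfl⟩, rfl⟩
  · rintro ⟨_, ⟨f, hf, hf0, rfl⟩, rfl⟩
    exact ⟨f, hf, hf0, rfl⟩

theorem restrictScalars_leadingIdeal (I : Ideal (MvPolynomial (Fin n) K)) :
    (leadingIdeal I).restrictScalars K = restrictSupport K (ltSet I) := by
  ext p
  rw [Submodule.restrictScalars_mem, leadingIdeal_eq_span, mem_ideal_span_monomial_image,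
    mem_restrictSupport_iff]
  constructor
  · intro h a ha
    obtain ⟨b, hb, hba⟩ := h a ha
    exact isUpperSet_ltSet I hba hb
  · exact fun h a ha => ⟨a, h ha, le_rfl⟩

theorem monomial_mem_leadingIdeal {I : Ideal (MvPolynomial (Fin n) K)} {a : Fin n →₀ ℕ} :
    monomial a (1 : K) ∈ leadingIdeal I ↔ a ∈ ltSet I := by
  rw [← Submodule.restrictScalars_mem K, restrictScalars_leadingIdeal,
    monomial_mem_restrictSupport]
  simp

/-- Spanning half of Macaulay's theorem, relative to T: a leading monomial is replaced modulo I by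
smaller ones, by well-founded induction, and `hT` keeps the reduction inside T. It serves both for
degree equal to s and for degree at most s. -/
theorem map_restrictSupport_diff_ltSet (I : Ideal (MvPolynomial (Fin n) K))
    (T : Set (Fin n →₀ ℕ))
    (hT : ∀ a ∈ T, a ∈ ltSet I → ∃ f ∈ I, f ≠ 0 ∧ ltExp f = a ∧ (f.support : Set _) ⊆ T) :
    (restrictSupport K (T \ ltSet I)).map (Ideal.Quotient.mkₐ K I).toLinearMap =
      (restrictSupport K T).map (Ideal.Quotient.mkₐ K I).toLinearMap := by
  classical
  refine le_antisymm (Submodule.map_mono (restrictSupport_mono _ Set.sdiff_subset)) ?_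
  set φ := (Ideal.Quotient.mkₐ K I).toLinearMap
  set W := (restrictSupport K (T \ ltSet I)).map φ
  have hmon : ∀ x : (degRevLex n).syn, ∀ a : Fin n →₀ ℕ, (degRevLex n).toSyn a = x → a ∈ T →
      φ (monomial a 1) ∈ W := by
    intro x
    induction x using WellFoundedLT.induction with
    | ind x ih =>
    rintro a rfl ha
    by_cases haS : a ∈ ltSet I
    · obtain ⟨f, hfI, hf0, hfa, hfT⟩ := hT a ha haS
      have hc : f.coeff a ≠ 0 := by
        rw [← hfa]
        exact (MonomialOrder.leadingCoeff_ne_zero_iff).2 hf0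
      have hmem : a ∈ f.support := mem_support_iff.2 hc
      have hφf : φ f = 0 := Ideal.Quotient.eq_zero_iff_mem.2 hfI
      rw [f.as_sum, ← Finset.add_sum_erase _ _ hmem, map_add, map_sum] at hφf
      have hlead : φ (monomial a 1) = (f.coeff a)⁻¹ • φ (monomial a (f.coeff a)) := by
        rw [← map_smul, smul_monomial, smul_eq_mul, inv_mul_cancel₀ hc]
      rw [hlead, eq_neg_of_add_eq_zero_left hφf]
      refine W.smul_mem _ (W.neg_mem (W.sum_mem fun b hb => ?_))
      obtain ⟨hba, hb⟩ := Finset.mem_erase.1 hb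
      have hlt : (degRevLex n).toSyn b < (degRevLex n).toSyn a := by
        refine lt_of_le_of_ne ?_ fun h => hba ((degRevLex n).toSyn.injective h)
        rw [← hfa]
        exact (degRevLex n).le_degree hb
      have := W.smul_mem (f.coeff b) (ih _ hlt b rfl (hfT hb))
      rwa [← map_smul, smul_monomial, smul_eq_mul, mul_one] at this
    · exact Submodule.mem_map_of_mem ((monomial_mem_restrictSupport K).2 (Or.inl ⟨ha, haS⟩))
  rw [restrictSupport_eq_span K T, Submodule.map_span, Submodule.span_le]
  rintro _ ⟨_, ⟨a, ha, rfl⟩, rfl⟩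
  exact hmon _ a rfl ha

/-- Independence half: a nonzero element of I has its leading exponent in `ltSet I`, so it cannot be
supported outside. -/
theorem finrank_map_restrictSupport (I : Ideal (MvPolynomial (Fin n) K))
    (T : Set (Fin n →₀ ℕ))
    (hT : ∀ a ∈ T, a ∈ ltSet I → ∃ f ∈ I, f ≠ 0 ∧ ltExp f = a ∧ (f.support : Set _) ⊆ T) :
    Module.finrank K ((restrictSupport K T).map (Ideal.Quotient.mkₐ K I).toLinearMap) =
      (T \ ltSet I).ncard := by
  rw [← map_restrictSupport_diff_ltSet I T hT]
  set φ := (Ideal.Quotient.mkₐ K I).toLinearMap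
  have hinj : Function.Injective (φ.domRestrict (restrictSupport K (T \ ltSet I))) := by
    rw [← LinearMap.ker_eq_bot, LinearMap.ker_eq_bot']
    rintro ⟨f, hf⟩ h
    have hfI : f ∈ I := Ideal.Quotient.eq_zero_iff_mem.1 h
    by_contra hne
    have hf0 : f ≠ 0 := fun h => hne (Subtype.ext h)
    exact (hf (MonomialOrder.degree_mem_support (m := degRevLex n) hf0)).2 ⟨f, hfI, hf0, rfl⟩
  rw [← LinearMap.range_domRestrict, LinearMap.finrank_range_of_inj hinj,
    Module.finrank_eq_nat_card_basis (basisRestrictSupport K (T \ ltSet I))]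
  rfl

theorem homogeneousSubmodule_eq_restrictSupport (s : ℕ) :
    homogeneousSubmodule (Fin n) K s = restrictSupport K {a | a.degree = s} :=
  homogeneousSubmodule_eq_finsupp_supported _ _ s

theorem hilbertFunction_eq {I : Ideal (MvPolynomial (Fin n) K)}
    (hI : ∀ f ∈ I, ∀ s, homogeneousComponent s f ∈ I) (s : ℕ) :
    hilbertFunction I s = ({a | a.degree = s} \ ltSet I).ncard := by
  rw [hilbertFunction, homogeneousSubmodule_eq_restrictSupport, finrank_map_restrictSupport]
  rintro a ha ⟨f, hf, hf0, hfa⟩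
  have hcoeff : (homogeneousComponent s f).coeff a ≠ 0 := by
    rw [coeff_homogeneousComponent, if_pos (by exact ha), ← hfa]
    exact (MonomialOrder.leadingCoeff_ne_zero_iff).2 hf0
  -- The component in the degree of the leading term keeps that leading term and stays in I.
  refine ⟨homogeneousComponent s f, hI f hf s, fun h => hcoeff (by simp [h]), ?_, ?_⟩
  · refine (degRevLex n).toSyn.injective (le_antisymm ?_ ((degRevLex n).le_degree ?_))
    · rw [ltExp, MonomialOrder.degree_le_iff]
      intro b hb
      rw [← hfa]
      refine (degRevLex n).le_degree (mem_support_iff.2 fun h => ?_)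
      rw [mem_support_iff, coeff_homogeneousComponent, h] at hb
      simp at hb
    · exact mem_support_iff.2 hcoeff
  · intro b hb
    by_contra h
    rw [Finset.mem_coe, mem_support_iff, coeff_homogeneousComponent, if_neg (by exact h)] at hb
    exact hb rfl

theorem hilbertSeries_eq {I : Ideal (MvPolynomial (Fin n) K)}
    (hI : ∀ f ∈ I, ∀ s, homogeneousComponent s f ∈ I) :
    hilbertSeries I = degreeSeries (ltSet I)ᶜ := by
  ext s
  rw [hilbertSeries, PowerSeries.coeff_mk, coeff_degreeSeries, hilbertFunction_eq hI, Set.inter_comm,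
    Set.sdiff_eq]

theorem finrank_map_restrictSupport_degree_le (I : Ideal (MvPolynomial (Fin n) K)) (s : ℕ) :
    Module.finrank K ((restrictSupport K {a : Fin n →₀ ℕ | a.degree ≤ s}).map
      (Ideal.Quotient.mkₐ K I).toLinearMap) = ({a | a.degree ≤ s} \ ltSet I).ncard := by
  refine finrank_map_restrictSupport _ _ ?_
  rintro a ha ⟨f, hf, hf0, rfl⟩
  refine ⟨f, hf, hf0, rfl, fun b hb => (?_ : b.degree ≤ _).trans ha⟩
  -- The order compares degrees first, so no term of f exceeds the degree of its leading term.
  by_contra! hlt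
  exact absurd ((degRevLex n).le_degree hb) (not_le.2 (degRevLex_lt_iff.2 (Or.inl hlt)))

theorem homogeneousComponent_mem_span {r : ℕ} {f : Fin r → MvPolynomial (Fin n) K} {d : Fin r → ℕ}
    (hf : ∀ i, (f i).IsHomogeneous (d i)) :
    ∀ p ∈ Ideal.span (Set.range f), ∀ s, homogeneousComponent s p ∈ Ideal.span (Set.range f) := by
  let _ := MvPolynomial.gradedAlgebra (σ := Fin n) (R := K)
  intro p hp s
  refine homogeneousComponent_mem_of_mem (Ideal.homogeneous_span _ _ ?_) hp s
  rintro _ ⟨i, rfl⟩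
  exact ⟨d i, hf i⟩

end LeadingExponents

end Pommaret

namespace Pommaret

/-! ### Cones and Pommaret bases -/

section Cones

open MvPolynomial

variable {K : Type*} [Field K] {n : ℕ}

theorem setOf_pommaretDvd (a : Fin n →₀ ℕ) :
    {b | PommaretDvd a b} = (a + ·) '' {c : Fin n →₀ ℕ | c.support ⊆ multVars a} := by
  ext b
  constructor
  · exact fun h => ⟨b - a, h.2, add_tsub_cancel_of_le h.1⟩
  · rintro ⟨c, hc, rfl⟩
    refine ⟨le_add_of_nonneg_right (zero_le (a := c)), ?_⟩
    simpa using hc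

theorem cone_eq_restrictSupport (a : Fin n →₀ ℕ) :
    cone K a = restrictSupport K {b | PommaretDvd a b} := by
  have hsupp : Subalgebra.toSubmodule (supported K (multVars a : Set (Fin n))) =
      restrictSupport K {c : Fin n →₀ ℕ | c.support ⊆ multVars a} := by
    ext p
    rw [Subalgebra.mem_toSubmodule, mem_supported, mem_restrictSupport_iff]
    constructor
    · exact fun h c hc i hi => h ((mem_vars_iff_mem_support i).2 ⟨c, hc, hi⟩)
    · intro h i hi
      obtain ⟨c, hc, hic⟩ := (mem_vars_iff_mem_support i).1 hi
      exact h hc hic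
  rw [cone, hsupp, setOf_pommaretDvd, restrictSupport_eq_span, restrictSupport_eq_span,
    Submodule.map_span, Set.image_image, Set.image_image]
  simp [monomial_mul, add_comm]

theorem degreeSeries_setOf_pommaretDvd (a : Fin n →₀ ℕ) :
    degreeSeries {b | PommaretDvd a b} * (1 - PowerSeries.X) ^ n =
      (1 - PowerSeries.X) ^ (n - (multVars a).card) * PowerSeries.X ^ a.degree := by
  have hcard : (multVars a).card + (n - (multVars a).card) = n :=
    Nat.add_sub_of_le ((Finset.card_le_univ _).trans_eq (Fintype.card_fin n))
  have hpow : (1 - PowerSeries.X : PowerSeries ℤ) ^ n =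
      (1 - PowerSeries.X) ^ (multVars a).card * (1 - PowerSeries.X) ^ (n - (multVars a).card) := by
    rw [← pow_add, hcard]
  rw [setOf_pommaretDvd, degreeSeries_translate, hpow]
  linear_combination PowerSeries.X ^ a.degree * (1 - PowerSeries.X) ^ (n - (multVars a).card) *
    degreeSeries_support_subset (multVars a)

theorem restrictSupport_iUnion {ι : Sort*} (A : ι → Set (Fin n →₀ ℕ)) :
    ⨆ i, restrictSupport K (A i) = restrictSupport K (⋃ i, A i) := by
  simp_rw [restrictSupport_eq_span, Set.image_iUnion, Submodule.span_iUnion]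

/-- With `restrictSupport_iUnion` and `restrictSupport_injective`, this turns a direct sum of cones
into a partition of exponent sets. -/
theorem disjoint_restrictSupport_iff {A B : Set (Fin n →₀ ℕ)} :
    Disjoint (restrictSupport K A) (restrictSupport K B) ↔ Disjoint A B := by
  rw [Submodule.disjoint_def, Set.disjoint_left]
  constructor
  · intro h a haA haB
    exact one_ne_zero ((monomial_eq_zero (R := K)).1 (h (monomial a 1)
      ((monomial_mem_restrictSupport K).2 (Or.inl haA))
      ((monomial_mem_restrictSupport K).2 (Or.inl haB))))
  · intro h p hpA hpB
    rw [← support_eq_empty, Finset.eq_empty_iff_forall_notMem]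
    exact fun a ha => h (hpA ha) (hpB ha)

theorem restrictSupport_injective :
    Function.Injective (restrictSupport K : Set (Fin n →₀ ℕ) → _) := by
  intro A B h
  ext a
  have := congrArg (monomial a (1 : K) ∈ ·) h
  simpa [monomial_mem_restrictSupport] using this

theorem exists_isPommaretBasis {I : Ideal (MvPolynomial (Fin n) K)}
    (hI : IsInQuasiStablePosition I) : ∃ H, IsPommaretBasis I H := by
  classical
  have hfin : (pommaretMinimal (ltSet I)).Finite := by
    refine finite_pommaretMinimal (isUpperSet_ltSet I) fun a ha i j hji s hs hsa => ?_
    obtain ⟨t, ht⟩ := hI.2 a (monomial_mem_leadingIdeal.2 ha) i j hji s hs hsa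
    exact ⟨t, monomial_mem_leadingIdeal.1 ht⟩
  have hex : ∀ b, ∃ h : MvPolynomial (Fin n) K, b ∈ ltSet I → h ∈ I ∧ h ≠ 0 ∧ ltExp h = b := by
    intro b
    by_cases hb : b ∈ ltSet I
    · obtain ⟨h, hh⟩ := hb
      exact ⟨h, fun _ => hh⟩
    · exact ⟨0, fun h => absurd h hb⟩
  choose φ hφ using hex
  -- Since `φ (ltExp h) = h`, distinct chosen elements have distinct leading exponents.
  have hmem : ∀ h ∈ hfin.toFinset.image φ, ltExp h ∈ pommaretMinimal (ltSet I) ∧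
      φ (ltExp h) = h ∧ h ∈ I ∧ h ≠ 0 := by
    intro h hh
    obtain ⟨b, hb, rfl⟩ := Finset.mem_image.1 hh
    rw [hfin.mem_toFinset] at hb
    obtain ⟨h₁, h₂, h₃⟩ := hφ b hb.1
    rw [h₃]
    exact ⟨hb, rfl, h₁, h₂⟩
  refine ⟨hfin.toFinset.image φ, fun h hh => (hmem h hh).2.2.1, fun h hh => (hmem h hh).2.2.2,
    ?_, ?_, ?_⟩
  · intro h hh g hg hne hdvd
    have := (hmem g hg).1.2 _ (hmem h hh).1.1 hdvd
    exact hne (by rw [← (hmem h hh).2.1, ← (hmem g hg).2.1, this])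
  · simp_rw [cone_eq_restrictSupport]
    intro h
    simp_rw [restrictSupport_iUnion]
    rw [disjoint_restrictSupport_iff, Set.disjoint_iUnion₂_right]
    intro g hne
    rw [Set.disjoint_left]
    intro a hha hga
    have := pommaretMinimal_unique (hmem h.1 h.2).1 (hmem g.1 g.2).1 hha hga
    exact hne (Subtype.ext (by rw [← (hmem h.1 h.2).2.1, ← (hmem g.1 g.2).2.1, this]))
  · simp_rw [cone_eq_restrictSupport, restrictSupport_iUnion, restrictScalars_leadingIdeal]
    congr 1
    ext a
    rw [Set.mem_iUnion]
    constructor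
    · rintro ⟨h, ha⟩
      exact isUpperSet_ltSet I ha.1 (hmem h.1 h.2).1.1
    · intro ha
      obtain ⟨b, hb, hba⟩ := exists_pommaretMinimal_dvd ha
      refine ⟨⟨φ b, Finset.mem_image_of_mem φ (hfin.mem_toFinset.2 hb)⟩, ?_⟩
      rw [Set.mem_ofPred_eq, (hφ b hb.1).2.2]
      exact hba

theorem IsPommaretBasis.hilbertSeries_mul {I : Ideal (MvPolynomial (Fin n) K)}
    (hI : ∀ f ∈ I, ∀ s, homogeneousComponent s f ∈ I) {H : Finset (MvPolynomial (Fin n) K)}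
    (hH : IsPommaretBasis I H) :
    hilbertSeries I * (1 - PowerSeries.X) ^ n =
      1 - ∑ h ∈ H, (1 - PowerSeries.X) ^ numNonMult h * PowerSeries.X ^ ltDeg h := by
  have hdisj : (H : Set (MvPolynomial (Fin n) K)).PairwiseDisjoint
      fun h => {b | PommaretDvd (ltExp h) b} := by
    intro h hh g hg hne
    have := hH.indep.pairwiseDisjoint (i := ⟨h, hh⟩) (j := ⟨g, hg⟩)
      (fun he => hne (congrArg Subtype.val he))
    simpa only [Function.onFun, cone_eq_restrictSupport, disjoint_restrictSupport_iff] using this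
  have hunion : ltSet I = ⋃ h ∈ H, {b | PommaretDvd (ltExp h) b} := by
    have := hH.iSup_eq
    simp_rw [cone_eq_restrictSupport] at this
    rw [restrictSupport_iUnion, restrictScalars_leadingIdeal] at this
    rw [← restrictSupport_injective this, Set.iUnion_subtype]
  rw [hilbertSeries_eq hI, degreeSeries_compl, sub_mul, degreeSeries_univ, hunion,
    degreeSeries_biUnion _ _ hdisj, Finset.sum_mul]
  simp_rw [degreeSeries_setOf_pommaretDvd]
  rfl

end Cones

end Pommaret

/-! ### Integral extensions and polynomial growth -/

theorem ringKrullDim_eq_of_isIntegral_of_injective {R S : Type*} [CommRing R] [CommRing S]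
    (f : R →+* S) (hf : f.IsIntegral) (hinj : Function.Injective f) :
    ringKrullDim S = ringKrullDim R := by
  algebraize [f]
  -- Incomparability gives one inequality; lying over and going up lift chains for the other.
  refine le_antisymm ?_ (iSup_le fun l => ?_)
  · exact Order.krullDim_le_of_strictMono (PrimeSpectrum.comap (algebraMap R S))
      fun P Q h => Ideal.IsIntegral.comap_lt_comap (I := P.asIdeal) (J := Q.asIdeal) h
  · have : FaithfulSMul R S := (faithfulSMul_iff_algebraMap_injective R S).2 hinj
    obtain ⟨Q, hQ, hQl⟩ := (inferInstance : Nonempty (Ideal.primesOver l.head.asIdeal S))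
    obtain ⟨L, hL, -, -⟩ := Ideal.exists_ltSeries_of_hasGoingUp (S := S) l Q
    rw [← hL]
    exact le_iSup (fun L : LTSeries (PrimeSpectrum S) => (L.length : WithBot ℕ∞)) L

/-- Otherwise p = O(q) = o(p) along the naturals, although p is eventually nonzero there. -/
theorem Polynomial.natDegree_le_of_eventually_eval_natCast_le {p q : Polynomial ℝ}
    (h0 : ∀ᶠ s : ℕ in Filter.atTop, 0 ≤ p.eval (s : ℝ))
    (h : ∀ᶠ s : ℕ in Filter.atTop, p.eval (s : ℝ) ≤ q.eval (s : ℝ)) :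
    p.natDegree ≤ q.natDegree := by
  by_contra! hlt
  have hp : p ≠ 0 := by
    rintro rfl
    simp at hlt
  have hdeg : q.degree < p.degree := Polynomial.degree_lt_degree hlt
  have ho := (Polynomial.isLittleO_atTop_of_degree_lt q p hdeg).comp_tendsto
    tendsto_natCast_atTop_atTop (k := ((↑) : ℕ → ℝ))
  have hO : (fun s : ℕ => p.eval (s : ℝ)) =O[Filter.atTop] fun s : ℕ => q.eval (s : ℝ) := by
    refine Asymptotics.IsBigO.of_bound 1 ?_
    filter_upwards [h0, h] with s hs0 hs
    rw [one_mul, Real.norm_of_nonneg hs0, Real.norm_of_nonneg (hs0.trans hs)]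
    exact hs
  refine Asymptotics.isLittleO_irrefl ?_ (hO.trans_isLittleO ho)
  exact ((tendsto_natCast_atTop_atTop (R := ℝ)).eventually
    (Polynomial.eventually_atTop_not_isRoot p hp)).frequently

namespace Pommaret

/-! ### Growth of the degree filtration of an affine algebra -/

section Filtration

open MvPolynomial

variable {K : Type*} [Field K] {n : ℕ}

variable (K n) in
/-- The polynomials of total degree at most `s`. -/
noncomputable def degreeLE (s : ℕ) : Submodule K (MvPolynomial (Fin n) K) :=
  restrictSupport K {a | a.degree ≤ s}

theorem degreeLE_mono : Monotone (degreeLE K n) :=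
  fun _ _ h => restrictSupport_mono _ fun _ (ha : _ ≤ _) => ha.trans h

theorem degreeLE_mul_le (s t : ℕ) : degreeLE K n s * degreeLE K n t ≤ degreeLE K n (s + t) := by
  rw [degreeLE, degreeLE, ← restrictSupport_add]
  refine restrictSupport_mono _ ?_
  rintro _ ⟨a, ha, b, hb, rfl⟩
  simp only [Set.mem_ofPred_eq, map_add] at ha hb ⊢
  omega

theorem degreeLE_succ_le (s : ℕ) : degreeLE K n (s + 1) ≤ degreeLE K n 1 * degreeLE K n s := by
  rw [degreeLE, degreeLE, degreeLE, ← restrictSupport_add]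
  refine restrictSupport_mono _ fun a (ha : a.degree ≤ s + 1) => ?_
  rcases eq_or_ne a 0 with rfl | h0
  · exact ⟨0, by simp, 0, by simp, by simp⟩
  · obtain ⟨i, hi⟩ := Finsupp.ne_iff.1 h0
    have hle : Finsupp.single i 1 ≤ a := Finsupp.single_le_iff.2 (Nat.one_le_iff_ne_zero.2 hi)
    obtain ⟨b, rfl⟩ := exists_add_of_le hle
    refine ⟨_, by simp, b, ?_, rfl⟩
    simp only [Set.mem_ofPred_eq, map_add, Finsupp.degree_single] at ha ⊢
    omega

theorem one_mem_degreeLE (s : ℕ) : 1 ∈ degreeLE K n s :=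
  (monomial_mem_restrictSupport K).2 (Or.inl (by simp))

theorem degreeLE_zero_le : degreeLE K n 0 ≤ 1 := by
  rw [degreeLE, restrictSupport_eq_span, Submodule.span_le]
  rintro _ ⟨a, ha, rfl⟩
  obtain rfl : a = 0 := (Finsupp.degree_eq_zero_iff a).1 (Nat.le_zero.1 ha)
  exact Submodule.one_le.1 le_rfl

theorem exists_mem_degreeLE (p : MvPolynomial (Fin n) K) : ∃ s, p ∈ degreeLE K n s :=
  ⟨p.support.sup Finsupp.degree, fun _ ha => Finset.le_sup (f := Finsupp.degree) ha⟩

instance finite_degreeLE (s : ℕ) : Module.Finite K (degreeLE K n s) :=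
  have : Finite {a : Fin n →₀ ℕ | a.degree ≤ s} := Finsupp.finite_of_degree_le s
  Module.Finite.of_basis (basisRestrictSupport K _)

theorem card_Icc_const (k : ℕ) :
    (Finset.Icc 0 (Finsupp.equivFunOnFinite.symm fun _ : Fin n => k)).card = (k + 1) ^ n := by
  rw [Finsupp.card_Icc, Finset.prod_subset (Finset.subset_univ _)]
  · simp
  · intro i _ hi
    simpa using hi

theorem setOf_degree_le_subset_Icc (s : ℕ) : {a : Fin n →₀ ℕ | a.degree ≤ s} ⊆
    Finset.Icc 0 (Finsupp.equivFunOnFinite.symm fun _ : Fin n => s) := by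
  intro a ha
  rw [Finset.coe_Icc]
  exact ⟨zero_le, fun i => (Finsupp.le_degree i a).trans ha⟩

/-- The box of exponent vectors with entries at most k lies in degree at most nk. -/
theorem pow_le_finrank_degreeLE (k : ℕ) : (k + 1) ^ n ≤ Module.finrank K (degreeLE K n (n * k)) := by
  rw [degreeLE, Module.finrank_eq_nat_card_basis (basisRestrictSupport K _), ← card_Icc_const,
    ← Set.ncard_coe_finset]
  refine Set.ncard_le_ncard (fun a ha => ?_) (Finsupp.finite_of_degree_le _)
  rw [Finset.coe_Icc] at ha
  show a.degree ≤ n * k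
  rw [Finsupp.degree_eq_sum]
  exact (Finset.sum_le_sum fun i _ => ha.2 i).trans_eq (by simp)

variable {A : Type*} [CommRing A] [Algebra K A]

theorem exists_le_of_fg {V : Submodule K A} (hV : V.FG) {W : ℕ → Submodule K A} (hW : Monotone W)
    (hex : ∀ x, ∃ t, x ∈ W t) : ∃ t, V ≤ W t := by
  obtain ⟨G, rfl⟩ := hV
  choose t ht using hex
  exact ⟨G.sup t, Submodule.span_le.2 fun x hx => hW (Finset.le_sup hx) (ht x)⟩

/-- The images of the D variables lie in a single step e of the filtration, so g sends polynomials
of degree at most Dk injectively into step eDk. -/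
theorem exists_pow_le_finrank {D : ℕ} (π : MvPolynomial (Fin n) K →ₐ[K] A)
    (hπ : Function.Surjective π) (g : MvPolynomial (Fin D) K →ₐ[K] A)
    (hg : Function.Injective g) :
    ∃ c, ∀ k, (k + 1) ^ D ≤ Module.finrank K ((degreeLE K n (c * k)).map π.toLinearMap) := by
  set F : ℕ → Submodule K A := fun s => (degreeLE K n s).map π.toLinearMap
  have hF : Monotone F := fun _ _ h => Submodule.map_mono (degreeLE_mono h)
  have hmul : ∀ s t x y, x ∈ F s → y ∈ F t → x * y ∈ F (s + t) := by
    rintro s t _ _ ⟨p, hp, rfl⟩ ⟨q, hq, rfl⟩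
    exact ⟨p * q, degreeLE_mul_le s t (Submodule.mul_mem_mul hp hq), map_mul π p q⟩
  have hone : 1 ∈ F 0 := ⟨1, one_mem_degreeLE 0, map_one π⟩
  obtain ⟨e, he⟩ := exists_le_of_fg (V := Submodule.span K (Set.range fun i => g (X i)))
    (Submodule.fg_span (Set.finite_range _)) hF (fun x => by
      obtain ⟨p, rfl⟩ := hπ x
      obtain ⟨s, hs⟩ := exists_mem_degreeLE p
      exact ⟨s, p, hs, rfl⟩)
  have hmon : ∀ a : Fin D →₀ ℕ, g (monomial a 1) ∈ F (e * a.degree) := by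
    intro a
    induction a using Finsupp.induction_linear with
    | zero => simpa using hone
    | add a b ha hb =>
      have := hmul _ _ _ _ ha hb
      rwa [← map_mul, monomial_mul, one_mul, ← mul_add, ← map_add] at this
    | single i k =>
      induction k with
      | zero => simpa using hone
      | succ k ih =>
        have := hmul _ _ _ _ ih (he (Submodule.subset_span ⟨i, rfl⟩))
        rw [← map_mul, X, monomial_mul, one_mul, ← Finsupp.single_add] at this
        simpa [mul_add] using this
  refine ⟨e * D, fun k => (pow_le_finrank_degreeLE (K := K) k).trans ?_⟩
  rw [(Submodule.equivMapOfInjective g.toLinearMap hg (degreeLE K D (D * k))).finrank_eq]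
  refine Submodule.finrank_mono ?_
  rw [degreeLE, restrictSupport_eq_span, Submodule.map_span, Submodule.span_le]
  rintro _ ⟨_, ⟨a, ha, rfl⟩, rfl⟩
  refine hF ?_ (hmon a)
  rw [mul_assoc]
  exact Nat.mul_le_mul_left e ha

/-- With V spanned by finitely many module generators, multiplication by F 1 sends V into B c * V.
Iterating bounds F s by B of an index linear in s, times V. -/
theorem exists_finrank_le_pow {D : ℕ} (π : MvPolynomial (Fin n) K →ₐ[K] A)
    (g : MvPolynomial (Fin D) K →ₐ[K] A) (hg : g.Finite) :
    ∃ c m, ∀ s, Module.finrank K ((degreeLE K n s).map π.toLinearMap) ≤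
      m * (c * (s + 1) + 1) ^ D := by
  classical
  set F : ℕ → Submodule K A := fun s => (degreeLE K n s).map π.toLinearMap
  set B : ℕ → Submodule K A := fun t => (degreeLE K D t).map g.toLinearMap
  have hB : Monotone B := fun _ _ h => Submodule.map_mono (degreeLE_mono h)
  have hBmul : ∀ s t, B s * B t ≤ B (s + t) := fun s t => by
    rw [← Submodule.map_mul]
    exact Submodule.map_mono (degreeLE_mul_le s t)
  obtain ⟨G, hG⟩ : ∃ G : Finset A, ∀ x, ∃ t, x ∈ B t * Submodule.span K (G : Set A) := by
    let _ := g.toRingHom.toAlgebra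
    obtain ⟨G, hG⟩ : (⊤ : Submodule (MvPolynomial (Fin D) K) A).FG := hg.fg_top
    refine ⟨G, fun x => ?_⟩
    have hx : x ∈ Submodule.span (MvPolynomial (Fin D) K) (G : Set A) := hG ▸ trivial
    induction hx using Submodule.span_induction with
    | mem x hx =>
      refine ⟨0, ?_⟩
      rw [← one_mul x]
      exact Submodule.mul_mem_mul ⟨1, one_mem_degreeLE 0, map_one g⟩ (Submodule.subset_span hx)
    | zero => exact ⟨0, zero_mem _⟩
    | add x y _ _ hx hy =>
      obtain ⟨s, hs⟩ := hx
      obtain ⟨t, ht⟩ := hy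
      exact ⟨max s t, add_mem (mul_le_mul' (hB (le_max_left s t)) le_rfl hs)
        (mul_le_mul' (hB (le_max_right s t)) le_rfl ht)⟩
    | smul b x _ hx =>
      obtain ⟨t, ht⟩ := hx
      obtain ⟨s, hs⟩ := exists_mem_degreeLE b
      refine ⟨s + t, ?_⟩
      have := Submodule.mul_mem_mul (show g b ∈ B s from ⟨b, hs, rfl⟩) ht
      rw [← mul_assoc] at this
      exact mul_le_mul' (hBmul s t) le_rfl this
  set V := Submodule.span K (G : Set A)
  have hW : Monotone fun t => B t * V := fun _ _ h => mul_le_mul' (hB h) le_rfl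
  -- Including 1 lets the same constant c cover the base case F 0; this is why the index below is
  -- c(s + 1).
  have hfg : (F 1 * V ⊔ 1).FG :=
    ((((Module.Finite.iff_fg.1 inferInstance : (degreeLE K n 1).FG).map _).mul
      (Submodule.fg_span G.finite_toSet))).sup
      (Submodule.one_eq_span (R := K) (A := A) ▸ Submodule.fg_span_singleton 1)
  obtain ⟨c, hc⟩ := exists_le_of_fg hfg hW hG
  have hFB : ∀ s, F s ≤ B (c * (s + 1)) * V := by
    intro s
    induction s with
    | zero =>
      refine le_trans ?_ ((le_sup_right.trans hc).trans_eq (by simp))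
      exact (Submodule.map_mono degreeLE_zero_le).trans_eq (Submodule.map_one π)
    | succ s ih =>
      calc F (s + 1) ≤ F 1 * F s := by
            rw [← Submodule.map_mul]
            exact Submodule.map_mono (degreeLE_succ_le s)
        _ ≤ F 1 * (B (c * (s + 1)) * V) := mul_le_mul' le_rfl ih
        _ = B (c * (s + 1)) * (F 1 * V) := mul_left_comm _ _ _
        _ ≤ B (c * (s + 1)) * (B c * V) := mul_le_mul' le_rfl (le_sup_left.trans hc)
        _ = (B (c * (s + 1)) * B c) * V := (mul_assoc _ _ _).symm
        _ ≤ B (c * (s + 1) + c) * V := mul_le_mul' (hBmul _ _) le_rfl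
        _ = B (c * (s + 1 + 1)) * V := by ring_nf
  refine ⟨c, G.card, fun s => ?_⟩
  set t := c * (s + 1)
  let M : Finset A := (Finset.Icc 0 (Finsupp.equivFunOnFinite.symm fun _ : Fin D => t)).image
    fun a => g (monomial a 1)
  have hBM : B t ≤ Submodule.span K (M : Set A) := by
    simp only [B]
    rw [degreeLE, restrictSupport_eq_span, Submodule.map_span, Submodule.span_le]
    rintro _ ⟨_, ⟨a, ha, rfl⟩, rfl⟩
    exact Submodule.subset_span (Finset.mem_image_of_mem _ (setOf_degree_le_subset_Icc t ha))
  have hle : F s ≤ Submodule.span K (Finset.image₂ (· * ·) M G : Set A) := by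
    refine (hFB s).trans ((mul_le_mul' hBM le_rfl).trans_eq ?_)
    rw [Submodule.span_mul_span, Finset.coe_image₂, Set.image2_mul]
  calc Module.finrank K (F s)
      ≤ Module.finrank K (Submodule.span K (Finset.image₂ (· * ·) M G : Set A)) :=
        Submodule.finrank_mono hle
    _ ≤ (Finset.image₂ (· * ·) M G).card := finrank_span_finset_le_card _
    _ ≤ M.card * G.card := Finset.card_image₂_le _ _ _
    _ ≤ (t + 1) ^ D * G.card :=
        Nat.mul_le_mul_right _ (Finset.card_image_le.trans_eq (card_Icc_const t))
    _ = G.card * (t + 1) ^ D := mul_comm _ _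

end Filtration

end Pommaret

namespace Pommaret

/-! ### Krull dimension as pole order -/

section KrullDimension

open MvPolynomial

variable {K : Type*} [Field K] {n : ℕ}

theorem zero_notMem_ltSet {I : Ideal (MvPolynomial (Fin n) K)} (hI : I ≠ ⊤) : 0 ∉ ltSet I := by
  rintro ⟨f, hf, hf0, h⟩
  have hC := MonomialOrder.eq_C_of_degree_eq_zero h
  refine hI (I.eq_top_of_isUnit_mem hf ?_)
  rw [hC]
  exact (isUnit_iff_ne_zero.2 (MonomialOrder.leadingCoeff_ne_zero_iff.2 hf0)).map C

theorem mk_ncard_degree_le_mul (A : Set (Fin n →₀ ℕ)) :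
    (PowerSeries.mk fun s => ((A ∩ {a | a.degree ≤ s}).ncard : ℤ)) * (1 - PowerSeries.X) =
      degreeSeries A := by
  ext s
  rw [mul_sub, mul_one, map_sub, coeff_degreeSeries]
  cases s with
  | zero => simp
  | succ s =>
    rw [PowerSeries.coeff_succ_mul_X, PowerSeries.coeff_mk, PowerSeries.coeff_mk]
    have hunion : A ∩ {a | a.degree ≤ s + 1} =
        (A ∩ {a | a.degree ≤ s}) ∪ (A ∩ {a | a.degree = s + 1}) := by
      ext a
      simp only [Set.mem_inter_iff, Set.mem_union, Set.mem_ofPred_eq, ← and_or_left]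
      exact and_congr_right fun _ => by omega
    rw [hunion, Set.ncard_union_eq _ ((Finsupp.finite_of_degree_le s).subset Set.inter_subset_right)
      (finite_inter_degree_eq A _)]
    · push_cast
      ring
    · rw [Set.disjoint_left]
      rintro a ⟨-, ha⟩ ⟨-, ha'⟩
      simp only [Set.mem_ofPred_eq] at ha ha'
      omega

/-- Cumulative counting divides the series by one more factor 1 - t, hence the parameter n + 1. -/
theorem eventually_ncard_degree_le_eq {A : Set (Fin n →₀ ℕ)} {N : Polynomial ℤ}
    (hN : degreeSeries A * (1 - PowerSeries.X) ^ n = (N : PowerSeries ℤ)) :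
    ∀ᶠ s : ℕ in Filter.atTop, ((A ∩ {a | a.degree ≤ s}).ncard : ℝ) =
      (Polynomial.hilbertPoly (N.map (Int.castRingHom ℝ)) (n + 1)).eval (s : ℝ) := by
  filter_upwards [Filter.eventually_gt_atTop (N.map (Int.castRingHom ℝ)).natDegree] with s hs
  rw [← Polynomial.coeff_mul_invOneSubPow_eq_hilbertPoly_eval _ hs]
  have h := congrArg (PowerSeries.map (Int.castRingHom ℝ)) hN
  rw [← mk_ncard_degree_le_mul, mul_assoc, ← pow_succ', map_mul, map_pow, map_sub, map_one,
    PowerSeries.map_X, ← Polynomial.polynomial_map_coe] at h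
  rw [← h, mul_assoc, ← PowerSeries.invOneSubPow_inv_eq_one_sub_pow, Units.inv_val, mul_one,
    PowerSeries.coeff_map, PowerSeries.coeff_mk]
  simp

theorem exists_krullDim_and_hilbertSeries_mul {I : Ideal (MvPolynomial (Fin n) K)}
    (hI : ∀ f ∈ I, ∀ s, homogeneousComponent s f ∈ I) (hne : I ≠ ⊤) :
    ∃ (D : ℕ) (N : Polynomial ℤ), ringKrullDim (MvPolynomial (Fin n) K ⧸ I) = D ∧ N.eval 1 ≠ 0 ∧
      hilbertSeries I * (1 - PowerSeries.X) ^ D = (N : PowerSeries ℤ) := by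
  have : Nontrivial (MvPolynomial (Fin n) K ⧸ I) := Ideal.Quotient.nontrivial_iff.2 hne
  -- Noether normalisation.
  obtain ⟨D, g, hg, hgfin⟩ := exists_finite_inj_algHom_of_fg K (MvPolynomial (Fin n) K ⧸ I)
  have hdim : ringKrullDim (MvPolynomial (Fin n) K ⧸ I) = D := by
    rw [ringKrullDim_eq_of_isIntegral_of_injective g.toRingHom
      (RingHom.Finite.to_isIntegral hgfin) hg]
    simp
  obtain ⟨M, hM⟩ : ∃ M : Polynomial ℤ,
      degreeSeries (ltSet I)ᶜ * (1 - PowerSeries.X) ^ n = (M : PowerSeries ℤ) := by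
    obtain ⟨M, hM⟩ := exists_polynomial_degreeSeries (isUpperSet_ltSet I)
    refine ⟨1 - M, ?_⟩
    rw [degreeSeries_compl, sub_mul, degreeSeries_univ, hM]
    simp
  set p := Polynomial.hilbertPoly (M.map (Int.castRingHom ℝ)) (n + 1) with hp_def
  have hp := eventually_ncard_degree_le_eq hM
  set H : ℕ → ℕ := fun s => ((ltSet I)ᶜ ∩ {a | a.degree ≤ s}).ncard
  have hrank : ∀ s, H s = Module.finrank K
      ((degreeLE K n s).map (Ideal.Quotient.mkₐ K I).toLinearMap) := fun s => by
    rw [degreeLE, finrank_map_restrictSupport_degree_le, Set.sdiff_eq, Set.inter_comm]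
  have hpos : ∀ s, 0 < H s := fun s =>
    (Set.ncard_pos ((Finsupp.finite_of_degree_le s).subset Set.inter_subset_right)).2
      ⟨0, zero_notMem_ltSet hne, by simp⟩
  have hp0 : p ≠ 0 := by
    intro h
    obtain ⟨s, hs⟩ := hp.exists
    rw [← hp_def, h, Polynomial.eval_zero, Nat.cast_eq_zero] at hs
    exact (hpos s).ne' hs
  have hdegree : p.natDegree = D := by
    refine le_antisymm ?_ ?_
    · obtain ⟨c, m, hcm⟩ := exists_finrank_le_pow (Ideal.Quotient.mkₐ K I) g hgfin
      let q : Polynomial ℝ := Polynomial.C (m : ℝ) *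
        (Polynomial.C (c : ℝ) * Polynomial.X + Polynomial.C (c + 1 : ℝ)) ^ D
      have hq : q.natDegree ≤ D :=
        (Polynomial.natDegree_C_mul_le _ _).trans
          ((Polynomial.natDegree_pow_le_of_le D Polynomial.natDegree_linear_le).trans_eq
            (mul_one D))
      refine (Polynomial.natDegree_le_of_eventually_eval_natCast_le (q := q) ?_ ?_).trans hq
      · filter_upwards [hp] with s hs
        rw [← hs]
        positivity
      · filter_upwards [hp] with s hs
        rw [← hs]
        have : (H s : ℝ) ≤ m * (c * (s + 1) + 1) ^ D := by
          rw [hrank]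
          exact_mod_cast hcm s
        refine this.trans_eq ?_
        simp only [q, Polynomial.eval_mul, Polynomial.eval_C, Polynomial.eval_pow,
          Polynomial.eval_add, Polynomial.eval_X]
        ring
    · obtain ⟨c, hc⟩ := exists_pow_le_finrank (Ideal.Quotient.mkₐ K I)
        (Ideal.Quotient.mkₐ_surjective K I) g hg
      -- Replacing c by c + 1 ensures that the argument tends to infinity even when c = 0.
      have hc1 : ∀ k, (k + 1) ^ D ≤ H ((c + 1) * k) := fun k => by
        rw [hrank]
        refine (hc k).trans (Submodule.finrank_mono (Submodule.map_mono (degreeLE_mono ?_)))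
        exact Nat.mul_le_mul_right k (Nat.le_succ c)
      let q : Polynomial ℝ := p.comp (Polynomial.C (c + 1 : ℝ) * Polynomial.X)
      have hq : q.natDegree ≤ p.natDegree :=
        Polynomial.natDegree_comp_le.trans
          ((Nat.mul_le_mul_left _ 
            ((Polynomial.natDegree_C_mul_le _ _).trans Polynomial.natDegree_X_le)).trans_eq (mul_one _))
      have hD : ((Polynomial.X + Polynomial.C 1 : Polynomial ℝ) ^ D).natDegree = D := by
        rw [Polynomial.natDegree_pow, Polynomial.natDegree_X_add_C, mul_one]
      rw [← hD]
      refine (Polynomial.natDegree_le_of_eventually_eval_natCast_le (q := q) ?_ ?_).trans hq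
      · filter_upwards with s
        simp only [Polynomial.eval_pow, Polynomial.eval_add, Polynomial.eval_X, Polynomial.eval_C]
        positivity
      · have htend : Filter.Tendsto (fun k : ℕ => (c + 1) * k) Filter.atTop Filter.atTop :=
          Filter.tendsto_id.const_mul_atTop' (Nat.succ_pos c)
        filter_upwards [htend.eventually hp] with k hk
        simp only [q, Polynomial.eval_pow, Polynomial.eval_add, Polynomial.eval_X,
          Polynomial.eval_C, Polynomial.eval_comp, Polynomial.eval_mul]
        push_cast at hk
        rw [← hk]
        exact_mod_cast hc1 k
  have hM0 : M ≠ 0 := by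
    rintro rfl
    exact hp0 (by rw [hp_def, Polynomial.map_zero, Polynomial.hilbertPoly_zero_left])
  set k := M.rootMultiplicity 1 with hk
  have hkmap : (M.map (Int.castRingHom ℝ)).rootMultiplicity 1 = k := by
    rw [hk, Polynomial.eq_rootMultiplicity_map (f := Int.castRingHom ℝ) Int.cast_injective, map_one]
  have hkn : D + k = n := by
    have h₁ := Polynomial.natDegree_hilbertPoly_of_ne_zero hp0
    -- Rules out truncation in the natural subtraction of the degree formula `h₁`.
    have h₂ : k < n + 1 := by
      by_contra! h
      exact hp0 (Polynomial.hilbertPoly_eq_zero_of_le_rootMultiplicity_one (by rwa [hkmap]))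
    rw [hkmap, ← hp_def, hdegree] at h₁
    omega
  obtain ⟨q, hq, hqdvd⟩ := Polynomial.exists_eq_pow_rootMultiplicity_mul_and_not_dvd M hM0 1
  -- The sign arises because M factors through (t - 1)^k while the denominator has (1 - t)^k.
  refine ⟨D, (-1) ^ k * q, hdim, ?_, ?_⟩
  · rw [Polynomial.dvd_iff_isRoot, Polynomial.IsRoot.def] at hqdvd
    simpa using hqdvd
  · have hX : (1 - PowerSeries.X : PowerSeries ℤ) ^ k ≠ 0 := by
      refine pow_ne_zero _ fun h => ?_
      simpa using congrArg PowerSeries.constantCoeff h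
    refine mul_right_cancel₀ hX ?_
    rw [hilbertSeries_eq hI, mul_assoc, ← pow_add, hkn, hM, hq, ← hk]
    push_cast
    rw [map_one, ← neg_sub (1 : PowerSeries ℤ) PowerSeries.X, neg_pow (1 - PowerSeries.X : PowerSeries ℤ) k]
    ring

end KrullDimension

end Pommaret

/-- Rationality of the Hilbert series of a homogeneous ideal with the Krull dimension as pole order,
and the explicit formula for the series in terms of a Pommaret basis. The identities between
quotients are written after multiplication by the unit `(1 - t)^D` resp. `(1 - t)^n` of `ℤ⟦t⟧`. -/
theorem mainTheorem3 {K : Type*} [Field K] [Infinite K] (n : ℕ)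
    (I : Ideal (MvPolynomial (Fin n) K)) (r : ℕ) (f : Fin r → MvPolynomial (Fin n) K)
    (d : Fin r → ℕ) (hf : ∀ i, (f i).IsHomogeneous (d i)) (hI : I = Ideal.span (Set.range f)) :
    (I ≠ ⊤ → ∃ (D : ℕ) (N : Polynomial ℤ),
        ringKrullDim (MvPolynomial (Fin n) K ⧸ I) = D ∧ N.eval 1 ≠ 0 ∧
        Pommaret.hilbertSeries I * (1 - PowerSeries.X) ^ D = (N : PowerSeries ℤ)) ∧
    (Pommaret.IsInQuasiStablePosition I → ∃ H, Pommaret.IsPommaretBasis I H) ∧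
    (∀ H, Pommaret.IsPommaretBasis I H →
        Pommaret.hilbertSeries I * (1 - PowerSeries.X) ^ n =
          1 - ∑ h ∈ H, (1 - PowerSeries.X) ^ Pommaret.numNonMult h *
            PowerSeries.X ^ Pommaret.ltDeg h) := by
  have hhom : ∀ p ∈ I, ∀ s, MvPolynomial.homogeneousComponent s p ∈ I := by
    rw [hI]
    exact Pommaret.homogeneousComponent_mem_span hf
  exact ⟨Pommaret.exists_krullDim_and_hilbertSeries_mul hhom, Pommaret.exists_isPommaretBasis,
    fun _ hH => hH.hilbertSeries_mul hhom⟩
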